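/- Let $\Delta$ be a connected graph (a connected simplicial complex of dimension at most $1$) on a finite vertex set, with $v$ vertices and $e$ edges, let $a > 1$ be an integer and let $\mathbb{K}$ be a field of characteristic $0$. Let $$A_\Delta(a) = \frac{\mathbb{K}[x_1,\dots,x_n]}{I_\Delta + (x_1^a,\dots,x_n^a)},$$ where $I_\Delta = (\prod_{i\in\sigma}x_i : \sigma\notin\Delta)$ is the Stanley–Reisner ideal of $\Delta$. The algebra $A = A_\Delta(a)$ has the weak Lefschetz property (WLP) if there is a linear form $L$ such that every multiplication map $\times L\colon A_i\to A_{i+1}$, $i\ge 0$, has full rank. For an integer $r>0$, let $\operatorname{hesd}(\Delta,r)$ be the $r$-fold half-hollow edgewise subdivision of $\Delta$: the simplicial complex whose faces are the sets $A$ of vectors in $\mathbb{Z}_{\ge 0}^n$ such that $\bigcup_{\mathbf b\in A}\operatorname{supp}(\mathbf b)\in\Delta$ and $A\subseteq\{\mathbf c+\mathbf e_i : 1\le i\le n\}$ for some $\mathbf c\in\mathbb{Z}_{\ge 0}^n$ with $c_1+\dots+c_n=r-1$. (For the graph $\Delta$ this is the graph obtained by replacing every edge by a path on $r+1$ vertices.)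 Then $A_\Delta(a)$ has the WLP if and only if 1. $v>e$, or 2. $v\le e$ and $\operatorname{hesd}(\Delta,a-1)$ is not bipartite. -/

import Mathlib

/-! ### Simplicial complexes -/

namespace PreAbstractSimplicialComplex

variable {V : Type*}

/-- The number of faces of dimension `k`, i.e. of faces with `k + 1` vertices. -/
noncomputable def numFaces (Δ : PreAbstractSimplicialComplex V) (k : ℕ) : ℕ :=
  Set.ncard {s : Finset V | s ∈ Δ ∧ s.card = k + 1}

/-- The `1`-skeleton of a simplicial complex: its vertices are the `0`-dimensional faces, and two
different vertices are adjacent when they span a `1`-dimensional face. -/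
def skeletonGraph [DecidableEq V] (Δ : PreAbstractSimplicialComplex V) :
    SimpleGraph {v : V // ({v} : Finset V) ∈ Δ} where
  Adj u w := u ≠ w ∧ ({u.1, w.1} : Finset V) ∈ Δ
  symm := ⟨fun _ _ h => ⟨h.1.symm, by rw [Finset.pair_comm]; exact h.2⟩⟩
  loopless := ⟨fun _ h => h.1 rfl⟩

/-- A connected graph, as a simplicial complex: all faces have dimension at most `1` and the
`1`-skeleton is connected (in particular, there is a vertex). -/
def IsConnectedGraph [DecidableEq V] (Δ : PreAbstractSimplicialComplex V) : Prop :=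
  (∀ s ∈ Δ, s.card ≤ 2) ∧ Δ.skeletonGraph.Connected

/-- The `r`-fold half-hollow edgewise subdivision of `Δ`, for `r > 0`. Its faces are nonempty
finite sets `A` of vectors in `ℕ^V` such that the union of the supports of the vectors in `A` is a
face of `Δ`, and `A` consists of vectors of the form `c + e_i` for one fixed vector `c` with
coordinate sum `r - 1`. -/
def hesd [DecidableEq V] (Δ : PreAbstractSimplicialComplex V) (r : ℕ) :
    PreAbstractSimplicialComplex (V →₀ ℕ) where
  faces := {A | A.Nonempty ∧ A.biUnion Finsupp.support ∈ Δ ∧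
    ∃ c : V →₀ ℕ, c.degree + 1 = r ∧ ∀ b ∈ A, ∃ i : V, b = c + Finsupp.single i 1}
  isRelLowerSet_faces := by
    rintro A ⟨hA, hface, c, hc, hAc⟩
    refine ⟨hA, fun B hBA hB => ⟨hB, ?_, c, hc, fun b hb => hAc b (hBA hb)⟩⟩
    refine (Δ.isRelLowerSet_faces hface).2 (Finset.biUnion_subset_biUnion_of_subset_left _ hBA) ?_
    obtain ⟨b, hb⟩ := hB
    obtain ⟨i, rfl⟩ := hAc b (hBA hb)
    exact ⟨i, Finset.mem_biUnion.2 ⟨_, hb, by simp⟩⟩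

end PreAbstractSimplicialComplex

/-! ### The monomial algebras -/

section Algebras

open MvPolynomial

variable (K : Type*) [Field K] {V : Type*}

/-- The Stanley-Reisner ideal of `Δ`, generated by the squarefree monomials supported on the
nonfaces of `Δ`. (The empty set is a face by convention, and is not recorded in Mathlib's type of
simplicial complexes.) -/
noncomputable def stanleyReisnerIdeal (Δ : PreAbstractSimplicialComplex V) : Ideal (MvPolynomial V K) :=
  Ideal.span {f | ∃ σ : Finset V, σ.Nonempty ∧ σ ∉ Δ ∧ f = ∏ i ∈ σ, X i}

/-- The ideal `I_Δ + (x_v ^ a : v ∈ V)`. -/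
noncomputable def definingIdeal (Δ : PreAbstractSimplicialComplex V) (a : ℕ) : Ideal (MvPolynomial V K) :=
  stanleyReisnerIdeal K Δ ⊔ Ideal.span (Set.range fun v : V => (X v : MvPolynomial V K) ^ a)

variable {K}

/-- The degree `i` part of the algebra `K[x_v : v ∈ V] / J`: the classes of the homogeneous
polynomials of degree `i`. -/
noncomputable def gradedPiece (J : Ideal (MvPolynomial V K)) (i : ℕ) :
    Submodule K (MvPolynomial V K ⧸ J) :=
  (homogeneousSubmodule V K i).map (Ideal.Quotient.mkₐ K J).toLinearMap

theorem mul_mem_gradedPiece (J : Ideal (MvPolynomial V K)) {i : ℕ}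
    {L x : MvPolynomial V K ⧸ J} (hL : L ∈ gradedPiece J 1) (hx : x ∈ gradedPiece J i) :
    L * x ∈ gradedPiece J (i + 1) := by
  obtain ⟨p, hp, rfl⟩ := hL
  obtain ⟨q, hq, rfl⟩ := hx
  refine ⟨p * q, ?_, map_mul (Ideal.Quotient.mkₐ K J) p q⟩
  rw [add_comm]
  exact IsHomogeneous.mul hp hq

/-- The multiplication map `×L : A_i → A_{i+1}` of `A = K[x_v : v ∈ V] / J` by an element
`L ∈ A_1`. -/
noncomputable def mulMap (J : Ideal (MvPolynomial V K)) (L : gradedPiece J 1) (i : ℕ) :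
    gradedPiece J i →ₗ[K] gradedPiece J (i + 1) :=
  (LinearMap.mulLeft K (L : MvPolynomial V K ⧸ J)).restrict
    fun _ hx => mul_mem_gradedPiece J L.2 hx

/-- The weak Lefschetz property of the standard graded artinian algebra
`A = K[x_v : v ∈ V] / J`: for some linear form `L`, every multiplication map `×L : A_i → A_{i+1}`
has full rank, i.e. is injective or surjective. -/
def HasWLP (J : Ideal (MvPolynomial V K)) : Prop :=
  ∃ L : gradedPiece J 1, ∀ i : ℕ,
    Function.Injective (mulMap J L i) ∨ Function.Surjective (mulMap J L i)

end Algebras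

/-! The nonzero monomials form a basis of $A$. In degree $0<d<a$ there are $v+e(d-1)$ of them, and
in degree $a$ only $e(a-1)$, since the pure powers have died. Take $L$ to be the sum of the
variables. An element with coefficients `f` is killed by $L$ when a sum of values of `f` vanishes at
each monomial one degree higher (`IsKilled`). At a monomial supported on an edge, this says that `f`
changes sign when one unit of exponent moves along that edge.

If $d+1<a$, the equation at $x_u^{d+1}$ has a single term, so `f` vanishes at pure powers and hence
everywhere (`IsKilled.eq_zero`). If $d\ge a$, multiplication by $L$ is surjective
(`mulMap_surjective`). Only degree $a-1$ is left. There the monomials are the vertices of `Δ.hesd (a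
- 1)`, the equations are its edges, and the kernel consists of the functions that change sign along
every edge. By connectedness it has dimension at most one, and in characteristic $0$ it vanishes
unless the subdivision is bipartite.

The dimensions in degrees $a-1$ and $a$ differ by $v-e$. If $v>e$, a kernel of dimension at most one
forces surjectivity. If $v\le e$, full rank means injectivity. This holds for $L$ when the
subdivision is not bipartite. When it is bipartite, a two-coloring twisted by the coefficients of an
arbitrary linear form gives a nonzero kernel element (`exists_isKilled_of_isBipartite`). -/

open MvPolynomial

/-! ### The monomial basis of the algebra. -/

section StandardMonomials

variable {V : Type*}

/-- The exponents of the monomials that are nonzero in `A_Δ(a)`. -/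
def IsStandard (Δ : PreAbstractSimplicialComplex V) (a : ℕ) (m : V →₀ ℕ) : Prop :=
  (m = 0 ∨ m.support ∈ Δ) ∧ ∀ v, m v < a

/-- The exponents of the nonzero monomials of degree `d` in `A_Δ(a)`. -/
def standardSet (Δ : PreAbstractSimplicialComplex V) (a d : ℕ) : Set (V →₀ ℕ) :=
  {m | IsStandard Δ a m ∧ m.degree = d}

theorem face_of_subset {Δ : PreAbstractSimplicialComplex V} {s t : Finset V} (hs : s ∈ Δ)
    (hts : t ⊆ s) (ht : t.Nonempty) : t ∈ Δ :=
  (Δ.isRelLowerSet_faces hs).2 hts ht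

theorem face_nonempty {Δ : PreAbstractSimplicialComplex V} {s : Finset V} (hs : s ∈ Δ) :
    s.Nonempty :=
  (Δ.isRelLowerSet_faces hs).1

/-- The ideal is monomial, so membership is tested exponent by exponent. An exponent lies above some
generator exactly when it is not standard (`key`). -/
theorem mem_definingIdeal_iff {K : Type*} [Field K] {Δ : PreAbstractSimplicialComplex V} {a : ℕ}
    {p : MvPolynomial V K} :
    p ∈ definingIdeal K Δ a ↔ ∀ m, IsStandard Δ a m → p.coeff m = 0 := by
  classical
  have hJ : definingIdeal K Δ a = Ideal.span ((fun s => monomial s (1 : K)) ''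
      ({g | ∃ σ : Finset V, σ.Nonempty ∧ σ ∉ Δ ∧ g = ∑ i ∈ σ, Finsupp.single i 1} ∪
        Set.range fun v => Finsupp.single v a)) := by
    rw [definingIdeal, stanleyReisnerIdeal, ← Ideal.span_union, Set.image_union]
    congr 2
    · ext f
      constructor
      · rintro ⟨σ, h1, h2, rfl⟩
        exact ⟨_, ⟨σ, h1, h2, rfl⟩, by simp [monomial_sum_one, X]⟩
      · rintro ⟨_, ⟨σ, h1, h2, rfl⟩, rfl⟩
        exact ⟨σ, h1, h2, by simp [monomial_sum_one, X]⟩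
    · rw [← Set.range_comp]
      congr 1
      funext v
      simp [X_pow_eq_monomial]
  have key : ∀ m : V →₀ ℕ, (∃ g ∈ ({g | ∃ σ : Finset V, σ.Nonempty ∧ σ ∉ Δ ∧
      g = ∑ i ∈ σ, Finsupp.single i 1} ∪ Set.range fun v => Finsupp.single v a), g ≤ m) ↔
      ¬ IsStandard Δ a m := by
    intro m
    constructor
    · rintro ⟨g, ⟨σ, h1, h2, rfl⟩ | ⟨v, rfl⟩, hg⟩ ⟨hm, hma⟩
      · have hsub : σ ⊆ m.support := by
          intro i hi
          have := hg i
          rw [Finsupp.finsetSum_apply] at this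
          simp only [Finsupp.single_apply, Finset.sum_ite_eq', hi, if_true] at this
          simp only [Finsupp.mem_support_iff]
          omega
        rcases hm with rfl | hm
        · obtain ⟨i, hi⟩ := h1
          simpa using hsub hi
        · exact h2 (face_of_subset hm hsub h1)
      · have h := hg v
        have h' := hma v
        simp only [Finsupp.single_eq_same] at h
        omega
    · intro h
      rw [IsStandard, not_and_or] at h
      rcases h with h | h
      · push Not at h
        refine ⟨_, Or.inl ⟨m.support, by simpa [Finset.nonempty_iff_ne_empty] using h.1, h.2, rfl⟩,
          fun i => ?_⟩
        rw [Finsupp.finsetSum_apply]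
        simp only [Finsupp.single_apply, Finset.sum_ite_eq']
        split_ifs with hi
        · exact Nat.one_le_iff_ne_zero.2 (Finsupp.mem_support_iff.1 hi)
        · exact Nat.zero_le _
      · push Not at h
        obtain ⟨v, hv⟩ := h
        exact ⟨_, Or.inr ⟨v, rfl⟩, by simpa using hv⟩
  rw [hJ, mem_ideal_span_monomial_image]
  simp only [key, mem_support_iff]
  exact forall_congr' fun m => ⟨fun h hm => by_contra fun h' => h h' hm, fun h h' hm => h' (h hm)⟩

theorem monomial_mem_definingIdeal {K : Type*} [Field K] {Δ : PreAbstractSimplicialComplex V}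
    {a : ℕ} {m : V →₀ ℕ} (hm : ¬ IsStandard Δ a m) (r : K) :
    monomial m r ∈ definingIdeal K Δ a := by
  classical
  rw [mem_definingIdeal_iff]
  intro m' hm'
  rw [coeff_monomial, if_neg]
  rintro rfl
  exact hm hm'

theorem standardSet_finite [Finite V] (Δ : PreAbstractSimplicialComplex V) (a d : ℕ) :
    (standardSet Δ a d).Finite :=
  (Finsupp.finite_of_degree_eq d).subset fun _ h => h.2

instance [Finite V] (Δ : PreAbstractSimplicialComplex V) (a d : ℕ) :
    Finite (standardSet Δ a d) :=
  (standardSet_finite Δ a d).to_subtype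

end StandardMonomials

/-! ### Coordinates on the graded pieces, and multiplication as a linear system. -/

section GradedPieces

variable {V : Type*} {K : Type*} [Field K] (Δ : PreAbstractSimplicialComplex V) (a : ℕ)

theorem mk_mem_gradedPiece {J : Ideal (MvPolynomial V K)} {d : ℕ} {p : MvPolynomial V K}
    (hp : p.IsHomogeneous d) : Ideal.Quotient.mk J p ∈ gradedPiece J d :=
  ⟨p, hp, rfl⟩

theorem exists_mk_eq {J : Ideal (MvPolynomial V K)} {d : ℕ} (x : gradedPiece J d) :
    ∃ (p : MvPolynomial V K) (hp : p.IsHomogeneous d), x = ⟨_, mk_mem_gradedPiece hp⟩ := by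
  obtain ⟨_, p, hp, rfl⟩ := x
  exact ⟨p, hp, rfl⟩

theorem mulMap_mk {J : Ideal (MvPolynomial V K)} {d : ℕ} {ℓ p : MvPolynomial V K}
    (hℓ : ℓ.IsHomogeneous 1) (hp : p.IsHomogeneous d) :
    (mulMap J ⟨_, mk_mem_gradedPiece hℓ⟩ d ⟨_, mk_mem_gradedPiece hp⟩ : MvPolynomial V K ⧸ J) =
      Ideal.Quotient.mk J (ℓ * p) := by
  rw [map_mul]
  rfl

theorem isHomogeneous_linearForm [Fintype V] (c : V → K) :
    (∑ v, C (c v) * X v : MvPolynomial V K).IsHomogeneous 1 :=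
  IsHomogeneous.sum _ _ _ fun v _ => isHomogeneous_C_mul_X (c v) v

/-- The linear form `∑ c_v x_v` as an element of the degree one part. -/
noncomputable def linearForm [Fintype V] (J : Ideal (MvPolynomial V K)) (c : V → K) :
    gradedPiece J 1 :=
  ⟨_, mk_mem_gradedPiece (isHomogeneous_linearForm c)⟩

theorem exists_eq_linearForm [Fintype V] {J : Ideal (MvPolynomial V K)} (L : gradedPiece J 1) :
    ∃ c : V → K, L = linearForm J c := by
  obtain ⟨ℓ, hℓ, rfl⟩ := exists_mk_eq L
  have h : ℓ ∈ homogeneousSubmodule V K 1 := hℓ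
  rw [homogeneousSubmodule_one_eq_span_X, Submodule.mem_span_range_iff_exists_fun] at h
  obtain ⟨c, rfl⟩ := h
  exact ⟨c, by simp only [linearForm, smul_eq_C_mul]⟩

theorem coeff_linearForm_mul [Fintype V] (c : V → K) (p : MvPolynomial V K) (m : V →₀ ℕ) :
    coeff m ((∑ v, C (c v) * X v) * p) =
      ∑ v ∈ m.support, c v * coeff (m - Finsupp.single v 1) p := by
  classical
  simp only [Finset.sum_mul, coeff_sum, mul_assoc, coeff_C_mul, coeff_X_mul', mul_ite, mul_zero,
    Finset.sum_ite_mem, Finset.univ_inter]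

variable {Δ a}

theorem mk_eq_zero_iff {d : ℕ} {p : MvPolynomial V K} (hp : p.IsHomogeneous d) :
    Ideal.Quotient.mk (definingIdeal K Δ a) p = 0 ↔ ∀ m ∈ standardSet Δ a d, p.coeff m = 0 := by
  rw [Ideal.Quotient.eq_zero_iff_mem, mem_definingIdeal_iff]
  refine ⟨fun h m hm => h m hm.1, fun h m hm => ?_⟩
  by_cases hd : m.degree = d
  · exact h m ⟨hm, hd⟩
  · exact hp.coeff_eq_zero hd

/-- The linear system that says that `∑ c_v x_v` kills the element of `A_Δ(a)_d` with
coefficients `f`. -/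
def IsKilled [Fintype V] (Δ : PreAbstractSimplicialComplex V) (a d : ℕ) (c : V → K)
    (f : (V →₀ ℕ) → K) : Prop :=
  ∀ m ∈ standardSet Δ a (d + 1), ∑ v ∈ m.support, c v * f (m - Finsupp.single v 1) = 0

theorem mulMap_eq_zero_iff [Fintype V] {d : ℕ} (c : V → K) {p : MvPolynomial V K}
    (hp : p.IsHomogeneous d) :
    mulMap (definingIdeal K Δ a) (linearForm _ c) d ⟨_, mk_mem_gradedPiece hp⟩ = 0 ↔
      IsKilled Δ a d c (fun m => p.coeff m) := by
  have hl := isHomogeneous_linearForm c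
  rw [← Subtype.coe_inj, linearForm, mulMap_mk hl hp, ZeroMemClass.coe_zero,
    mk_eq_zero_iff (d := d + 1) (by rw [add_comm]; exact hl.mul hp), IsKilled]
  simp only [coeff_linearForm_mul]

/-- Ensures that `IsKilled` only involves the values of `f` at standard monomials of degree `d`; its
other values are irrelevant. -/
theorem sub_single_mem_standardSet {d : ℕ} {m : V →₀ ℕ} (hm : m ∈ standardSet Δ a (d + 1)) {v : V}
    (hv : v ∈ m.support) : m - Finsupp.single v 1 ∈ standardSet Δ a d := by
  classical
  obtain ⟨⟨h1, h2⟩, h3⟩ := hm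
  have hle : Finsupp.single v 1 ≤ m := by
    rw [Finsupp.single_le_iff, Nat.one_le_iff_ne_zero]
    exact Finsupp.mem_support_iff.1 hv
  have hsub : (m - Finsupp.single v 1).support ⊆ m.support := Finsupp.support_mono tsub_le_self
  refine ⟨⟨?_, fun w => lt_of_le_of_lt (tsub_le_self (a := m) (b := Finsupp.single v 1) w) (h2 w)⟩,
    ?_⟩
  · by_cases h0 : m - Finsupp.single v 1 = 0
    · exact Or.inl h0
    · right
      rcases h1 with rfl | h1
      · simp at hv
      · exact face_of_subset h1 hsub (Finsupp.support_nonempty_iff.2 h0)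
  · have := congrArg Finsupp.degree (tsub_add_cancel_of_le hle)
    rw [map_add, Finsupp.degree_single] at this
    omega

variable [Finite V]

/-- The homogeneous polynomial with the given coefficients at the standard monomials. -/
noncomputable def ofCoeffs (Δ : PreAbstractSimplicialComplex V) (a d : ℕ) (f : (V →₀ ℕ) → K) :
    MvPolynomial V K :=
  ∑ m ∈ (standardSet_finite Δ a d).toFinset, monomial m (f m)

theorem isHomogeneous_ofCoeffs (d : ℕ) (f : (V →₀ ℕ) → K) :
    (ofCoeffs Δ a d f).IsHomogeneous d :=
  IsHomogeneous.sum _ _ _ fun _ hm =>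
    isHomogeneous_monomial _ ((standardSet_finite Δ a d).mem_toFinset.1 hm).2

theorem coeff_ofCoeffs {d : ℕ} (f : (V →₀ ℕ) → K) {m : V →₀ ℕ} (hm : m ∈ standardSet Δ a d) :
    (ofCoeffs Δ a d f).coeff m = f m := by
  classical
  rw [ofCoeffs, coeff_sum]
  simp only [coeff_monomial, Finset.sum_ite_eq']
  rw [if_pos ((standardSet_finite Δ a d).mem_toFinset.2 hm)]

variable (K Δ a) in
/-- The standard monomials form a basis of each graded piece. -/
theorem exists_gradedPiece_equiv (d : ℕ) :
    ∃ E : gradedPiece (definingIdeal K Δ a) d ≃ₗ[K] (standardSet Δ a d → K),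
      ∀ (p : MvPolynomial V K) (hp : p.IsHomogeneous d) (m : standardSet Δ a d),
        E ⟨_, mk_mem_gradedPiece hp⟩ m = p.coeff m := by
  classical
  have := Fintype.ofFinite (standardSet Δ a d)
  -- The equivalence is built from its inverse, which sends coefficients to a class and so needs no
  -- choice of representative.
  let F : (standardSet Δ a d → K) →ₗ[K] gradedPiece (definingIdeal K Δ a) d :=
    LinearMap.codRestrict _ ((Ideal.Quotient.mkₐ K (definingIdeal K Δ a)).toLinearMap ∘ₗ
      ∑ m : standardSet Δ a d, monomial m.1 ∘ₗ LinearMap.proj m) fun f => by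
        refine mk_mem_gradedPiece ?_
        simp only [LinearMap.sum_apply, LinearMap.comp_apply, LinearMap.proj_apply]
        exact IsHomogeneous.sum _ _ _ fun m _ => isHomogeneous_monomial _ m.2.2
  have hF : ∀ (p : MvPolynomial V K) (hp : p.IsHomogeneous d),
      F (fun m => p.coeff m) = ⟨_, mk_mem_gradedPiece hp⟩ := by
    intro p hp
    apply Subtype.ext
    change Ideal.Quotient.mk _ ((∑ m : standardSet Δ a d, monomial m.1 ∘ₗ LinearMap.proj m)
      (fun m => p.coeff m)) = Ideal.Quotient.mk _ p
    rw [← sub_eq_zero, ← map_sub]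
    simp only [LinearMap.sum_apply, LinearMap.comp_apply, LinearMap.proj_apply]
    rw [mk_eq_zero_iff (d := d)]
    · intro m hm
      rw [coeff_sub, coeff_sum, Finset.sum_eq_single ⟨m, hm⟩]
      · simp
      · intro m' _ h
        rw [coeff_monomial, if_neg fun h' => h (Subtype.ext h')]
      · simp
    · exact (IsHomogeneous.sum _ _ _ fun m' _ => isHomogeneous_monomial _ m'.2.2).sub hp
  have hbij : Function.Bijective F := by
    constructor
    · rw [injective_iff_map_eq_zero]
      intro f hf
      have h := congrArg Subtype.val hf
      change Ideal.Quotient.mk _ ((∑ m : standardSet Δ a d, monomial m.1 ∘ₗ LinearMap.proj m)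
        f) = 0 at h
      simp only [LinearMap.sum_apply, LinearMap.comp_apply, LinearMap.proj_apply] at h
      rw [mk_eq_zero_iff (IsHomogeneous.sum _ _ _ fun m _ => isHomogeneous_monomial _ m.2.2)] at h
      funext m
      have h' := h m m.2
      rw [coeff_sum, Finset.sum_eq_single m] at h'
      · simpa using h'
      · intro m' _ h
        rw [coeff_monomial, if_neg fun h' => h (Subtype.ext h')]
      · simp
    · intro x
      obtain ⟨p, hp, rfl⟩ := exists_mk_eq x
      exact ⟨_, hF p hp⟩
  refine ⟨(LinearEquiv.ofBijective F hbij).symm, fun p hp m => ?_⟩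
  rw [← hF p hp]
  exact congrFun ((LinearEquiv.ofBijective F hbij).symm_apply_apply _) m

instance (d : ℕ) : FiniteDimensional K (gradedPiece (definingIdeal K Δ a) d) :=
  (exists_gradedPiece_equiv K Δ a d).choose.symm.finiteDimensional

theorem finrank_gradedPiece (d : ℕ) :
    Module.finrank K (gradedPiece (definingIdeal K Δ a) d) = (standardSet Δ a d).ncard := by
  have := Fintype.ofFinite (standardSet Δ a d)
  rw [(exists_gradedPiece_equiv K Δ a d).choose.finrank_eq, Module.finrank_fintype_fun_eq_card,
    ← Nat.card_eq_fintype_card]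
  rfl

theorem mulMap_injective_iff [Fintype V] (d : ℕ) (c : V → K) :
    Function.Injective (mulMap (definingIdeal K Δ a) (linearForm _ c) d) ↔
      ∀ f : (V →₀ ℕ) → K, IsKilled Δ a d c f → ∀ m ∈ standardSet Δ a d, f m = 0 := by
  rw [injective_iff_map_eq_zero]
  constructor
  · intro h f hf m hm
    have := h ⟨_, mk_mem_gradedPiece (isHomogeneous_ofCoeffs (Δ := Δ) (a := a) d f)⟩ (by
      rw [mulMap_eq_zero_iff c (isHomogeneous_ofCoeffs d f)]
      intro m hm
      rw [← hf m hm]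
      exact Finset.sum_congr rfl fun v hv => by
        beta_reduce
        rw [coeff_ofCoeffs f (sub_single_mem_standardSet hm hv)])
    rw [← Subtype.coe_inj, ZeroMemClass.coe_zero, mk_eq_zero_iff (isHomogeneous_ofCoeffs d f)] at this
    rw [← coeff_ofCoeffs f hm, this m hm]
  · intro h x hx
    obtain ⟨p, hp, rfl⟩ := exists_mk_eq x
    rw [mulMap_eq_zero_iff c hp] at hx
    rw [← Subtype.coe_inj, ZeroMemClass.coe_zero, mk_eq_zero_iff hp]
    exact h _ hx

/-- If an element killed by `∑ c_v x_v` is determined by one of its coefficients, then the kernel of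
the multiplication has dimension at most one. -/
theorem finrank_ker_mulMap_le_one [Fintype V] (d : ℕ) (c : V → K) (m₀ : V →₀ ℕ)
    (hm₀ : m₀ ∈ standardSet Δ a d)
    (h : ∀ f : (V →₀ ℕ) → K, IsKilled Δ a d c f → f m₀ = 0 → ∀ m ∈ standardSet Δ a d, f m = 0) :
    Module.finrank K (LinearMap.ker (mulMap (definingIdeal K Δ a) (linearForm _ c) d)) ≤ 1 := by
  obtain ⟨E, hE⟩ := exists_gradedPiece_equiv K Δ a d
  let φ : LinearMap.ker (mulMap (definingIdeal K Δ a) (linearForm _ c) d) →ₗ[K] K :=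
    LinearMap.proj (R := K) (φ := fun _ => K) (⟨m₀, hm₀⟩ : standardSet Δ a d) ∘ₗ
      E.toLinearMap ∘ₗ Submodule.subtype _
  have hφ : Function.Injective φ := by
    rw [injective_iff_map_eq_zero]
    rintro ⟨x, hx⟩ hx0
    obtain ⟨p, hp, rfl⟩ := exists_mk_eq x
    rw [LinearMap.mem_ker, mulMap_eq_zero_iff c hp] at hx
    have hx0' : p.coeff m₀ = 0 := (hE p hp ⟨m₀, hm₀⟩).symm.trans hx0
    apply Subtype.ext
    apply Subtype.ext
    exact (mk_eq_zero_iff hp).2 (h _ hx hx0')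
  simpa using LinearMap.finrank_le_finrank_of_injective hφ

end GradedPieces

/-! ### Standard monomials of a graph: pure powers and monomials on edges. -/

section Combinatorics

variable {V : Type*} {Δ : PreAbstractSimplicialComplex V} {a d : ℕ}

theorem eq_single_add_single [DecidableEq V] {m : V →₀ ℕ} {u v : V} (huv : u ≠ v)
    (hm : m.support ⊆ {u, v}) :
    m = Finsupp.single u (m u) + Finsupp.single v (m v) := by
  ext w
  simp only [Finsupp.add_apply, Finsupp.single_apply]
  by_cases hu : u = w
  · subst hu
    simp [huv.symm]
  · by_cases hv : v = w
    · subst hv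
      simp [huv]
    · have : w ∉ m.support := fun h => by
        have := hm h
        simp only [Finset.mem_insert, Finset.mem_singleton] at this
        grind
      simpa [hu, hv] using this

theorem support_pair [DecidableEq V] {u v : V} (huv : u ≠ v) {i j : ℕ} (hi : i ≠ 0) (hj : j ≠ 0) :
    (Finsupp.single u i + Finsupp.single v j).support = {u, v} := by
  ext w
  simp only [Finsupp.mem_support_iff, Finsupp.add_apply, Finsupp.single_apply, Finset.mem_insert,
    Finset.mem_singleton]
  grind

theorem degree_pair (u v : V) (i j : ℕ) :
    (Finsupp.single u i + Finsupp.single v j).degree = i + j := by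
  simp

theorem pair_ne_pair {u v : V} (huv : u ≠ v) (i j : ℕ) :
    (Finsupp.single u i + Finsupp.single v (j + 1) : V →₀ ℕ) ≠
      Finsupp.single u (i + 1) + Finsupp.single v j := by
  intro h
  have := DFunLike.congr_fun h u
  simp [huv] at this

theorem single_mem_standardSet {u : V} (hu : {u} ∈ Δ) (hd : d < a) :
    Finsupp.single u d ∈ standardSet Δ a d := by
  classical
  refine ⟨⟨?_, fun w => ?_⟩, by simp⟩
  · rcases Nat.eq_zero_or_pos d with rfl | h
    · simp
    · right
      rwa [Finsupp.support_single _ h.ne']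
  · rw [Finsupp.single_apply]
    split_ifs <;> omega

theorem pair_mem_standardSet [DecidableEq V] {u v : V} (huv : u ≠ v) (he : {u, v} ∈ Δ) {i j : ℕ}
    (hi : i < a) (hj : j < a) :
    Finsupp.single u i + Finsupp.single v j ∈ standardSet Δ a (i + j) := by
  refine ⟨⟨?_, fun w => ?_⟩, by simp⟩
  · by_cases h : Finsupp.single u i + Finsupp.single v j = 0
    · exact Or.inl h
    · refine Or.inr (face_of_subset he ?_ (Finsupp.support_nonempty_iff.2 h))
      intro w hw
      simp only [Finsupp.mem_support_iff, Finsupp.add_apply, Finsupp.single_apply] at hw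
      simp only [Finset.mem_insert, Finset.mem_singleton]
      grind
  · simp only [Finsupp.add_apply, Finsupp.single_apply]
    grind

theorem face_eq [DecidableEq V] (hdim : ∀ s ∈ Δ, s.card ≤ 2) {s : Finset V} (hs : s ∈ Δ) {u v : V}
    (huv : u ≠ v) (hu : u ∈ s) (hv : v ∈ s) : s = {u, v} := by
  symm
  apply Finset.eq_of_subset_of_card_le
  · intro w hw
    simp only [Finset.mem_insert, Finset.mem_singleton] at hw
    rcases hw with rfl | rfl <;> assumption
  · rw [Finset.card_pair huv]
    exact hdim s hs

theorem standardSet_cases [DecidableEq V] (hdim : ∀ s ∈ Δ, s.card ≤ 2) {m : V →₀ ℕ}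
    (hm : m ∈ standardSet Δ a d) :
    (d = 0 ∧ m = 0) ∨ (∃ u, {u} ∈ Δ ∧ 0 < d ∧ d < a ∧ m = Finsupp.single u d) ∨
      ∃ u v i j, u ≠ v ∧ {u, v} ∈ Δ ∧ 0 < i ∧ 0 < j ∧ i < a ∧ j < a ∧ i + j = d ∧
        m = Finsupp.single u i + Finsupp.single v j := by
  obtain ⟨⟨rfl | h1, h2⟩, h3⟩ := hm
  · left
    simpa using h3.symm
  · right
    have hpos := Finset.card_pos.2 (face_nonempty h1)
    have hle := hdim _ h1
    obtain h | h : m.support.card = 1 ∨ m.support.card = 2 := by omega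
    · left
      rw [Finset.card_eq_one] at h
      obtain ⟨u, hu⟩ := h
      have hmu := Finsupp.support_eq_singleton.1 hu
      have hd : m u = d := by
        rw [hmu.2] at h3
        simpa using h3
      subst hd
      exact ⟨u, hu ▸ h1, Nat.pos_of_ne_zero hmu.1, h2 u, hmu.2⟩
    · right
      rw [Finset.card_eq_two] at h
      obtain ⟨u, v, huv, hs⟩ := h
      have hmm := eq_single_add_single huv hs.le
      have hu : u ∈ m.support := by simp [hs]
      have hv : v ∈ m.support := by simp [hs]
      refine ⟨u, v, m u, m v, huv, hs ▸ h1, Nat.pos_of_ne_zero (Finsupp.mem_support_iff.1 hu),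
        Nat.pos_of_ne_zero (Finsupp.mem_support_iff.1 hv), h2 u, h2 v, ?_, hmm⟩
      rw [← h3, hmm, degree_pair, ← hmm]

theorem vertex_of_edge [DecidableEq V] {u v : V} (he : {u, v} ∈ Δ) : {u} ∈ Δ :=
  face_of_subset he (by simp) (by simp)

/-- The coefficient equation at a monomial supported on an edge. -/
theorem sum_support_pair {K : Type*} [Field K] [DecidableEq V] {u v : V} (huv : u ≠ v) (i j : ℕ)
    (c : V → K) (f : (V →₀ ℕ) → K) :
    ∑ w ∈ (Finsupp.single u (i + 1) + Finsupp.single v (j + 1)).support,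
        c w * f (Finsupp.single u (i + 1) + Finsupp.single v (j + 1) - Finsupp.single w 1) =
      c u * f (Finsupp.single u i + Finsupp.single v (j + 1)) +
        c v * f (Finsupp.single u (i + 1) + Finsupp.single v j) := by
  rw [support_pair huv (by omega) (by omega), Finset.sum_pair huv]
  congr 3 <;>
  · ext w
    simp only [Finsupp.add_apply, Finsupp.tsub_apply, Finsupp.single_apply]
    grind

/-! ### Kernel elements of the sum of the variables. -/

section Killed

variable {K : Type*} [Field K] [DecidableEq V] [Fintype V] {f : (V →₀ ℕ) → K}

theorem IsKilled.edge {c : V → K} (hf : IsKilled Δ a d c f) {u v : V} (huv : u ≠ v)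
    (he : {u, v} ∈ Δ) {i j : ℕ} (hij : i + j + 1 = d) (hi : i + 1 < a) (hj : j + 1 < a) :
    c u * f (Finsupp.single u i + Finsupp.single v (j + 1)) +
      c v * f (Finsupp.single u (i + 1) + Finsupp.single v j) = 0 := by
  rw [← sum_support_pair huv]
  apply hf
  have := pair_mem_standardSet huv he hi hj
  rwa [show i + 1 + (j + 1) = d + 1 by omega] at this

/-- Each unit of exponent moved from `u` to `v` costs one sign. With `d < a`, the monomials whose
equations are used stay standard. -/
theorem IsKilled.eq_neg_one_pow_mul (hf : IsKilled Δ a d (fun _ => 1) f) (hd : d < a) {u v : V}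
    (huv : u ≠ v) (he : {u, v} ∈ Δ) {i j : ℕ} (hij : i + j = d) :
    f (Finsupp.single u i + Finsupp.single v j) = (-1) ^ j * f (Finsupp.single u d) := by
  induction j generalizing i with
  | zero =>
    subst hij
    simp
  | succ j ih =>
    have h := hf.edge huv he (i := i) (j := j) (by omega) (by omega) (by omega)
    rw [ih (by omega)] at h
    rw [pow_succ]
    linear_combination h

theorem IsKilled.single_eq (hf : IsKilled Δ a d (fun _ => 1) f) (hd : d < a) {u v : V}
    (huv : u ≠ v) (he : {u, v} ∈ Δ) :
    f (Finsupp.single v d) = (-1) ^ d * f (Finsupp.single u d) := by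
  have := hf.eq_neg_one_pow_mul hd huv he (i := 0) (j := d) (by omega)
  simpa using this

/-- As $x_u^{d+1}$ is still nonzero, its equation reads $f(x_u^d)=0$; the edge relations carry this
to all other monomials. -/
theorem IsKilled.eq_zero (hdim : ∀ s ∈ Δ, s.card ≤ 2) (hv : ∃ u, {u} ∈ Δ)
    (hf : IsKilled Δ a d (fun _ => 1) f) (hd : d + 1 < a) :
    ∀ m ∈ standardSet Δ a d, f m = 0 := by
  have hs : ∀ u, {u} ∈ Δ → f (Finsupp.single u d) = 0 := by
    intro u hu
    have := hf _ (single_mem_standardSet hu hd)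
    rw [Finsupp.support_single _ (by omega), Finset.sum_singleton, one_mul,
      ← Finsupp.single_tsub, Nat.add_sub_cancel] at this
    exact this
  intro m hm
  obtain ⟨rfl, rfl⟩ | ⟨u, hu, -, -, rfl⟩ | ⟨u, v, i, j, huv, he, -, -, -, -, hij, rfl⟩ :=
    standardSet_cases hdim hm
  · obtain ⟨u, hu⟩ := hv
    simpa using hs u hu
  · exact hs u hu
  · rw [hf.eq_neg_one_pow_mul (by omega) huv he hij, hs u (vertex_of_edge he), mul_zero]

/-- Signs propagate along a walk to `u₀`, so one value determines `f` up to signs. This bounds the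
kernel by dimension one and, in the non-bipartite case, supplies the candidate coloring. -/
theorem IsKilled.eq_or_eq_neg (hΔ : Δ.IsConnectedGraph) {u₀ : V} (hu₀ : {u₀} ∈ Δ)
    (hf : IsKilled Δ a d (fun _ => 1) f) (hd0 : d ≠ 0) (hd : d < a) {m : V →₀ ℕ}
    (hm : m ∈ standardSet Δ a d) :
    f m = f (Finsupp.single u₀ d) ∨ f m = -f (Finsupp.single u₀ d) := by
  have hs : ∀ u (hu : {u} ∈ Δ), f (Finsupp.single u d) = f (Finsupp.single u₀ d) ∨
      f (Finsupp.single u d) = -f (Finsupp.single u₀ d) := by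
    intro u hu
    obtain ⟨p⟩ := hΔ.2.preconnected ⟨u, hu⟩ ⟨u₀, hu₀⟩
    generalize hx : (⟨u, hu⟩ : {v : V // ({v} : Finset V) ∈ Δ}) = x at p
    generalize hy : (⟨u₀, hu₀⟩ : {v : V // ({v} : Finset V) ∈ Δ}) = y at p
    induction p generalizing u with
    | nil =>
      subst hy
      cases hx
      exact Or.inl rfl
    | @cons _ y _ h p ih =>
      subst hx
      have h1 := ih y.1 y.2 rfl hy
      have h2 := hf.single_eq hd (u := u) (v := y.1) (fun h' => h.1 (Subtype.ext h')) h.2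
      rcases neg_one_pow_eq_or K d with h3 | h3 <;> rw [h3] at h2 <;> grind
  obtain ⟨rfl, rfl⟩ | ⟨u, hu, -, -, rfl⟩ | ⟨u, v, i, j, huv, he, -, -, -, -, hij, rfl⟩ :=
    standardSet_cases hΔ.1 hm
  · exact absurd rfl hd0
  · exact hs u hu
  · rw [hf.eq_neg_one_pow_mul hd huv he hij]
    have := hs u (vertex_of_edge he)
    rcases neg_one_pow_eq_or K j with h3 | h3 <;> rw [h3] <;> grind

end Killed

/-! ### The subdivision as the graph of the linear system in degree $a-1$. -/

section Subdivision

variable [DecidableEq V]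

/-- In degree $a-1$ the bound on the exponents is automatic, so only the support condition remains.
-/
theorem singleton_mem_hesd_iff (ha : 1 < a) {b : V →₀ ℕ} :
    {b} ∈ Δ.hesd (a - 1) ↔ b ∈ standardSet Δ a (a - 1) := by
  constructor
  · rintro ⟨-, h1, c, hc, h2⟩
    obtain ⟨i, hi⟩ := h2 b (by simp)
    have hb : b.degree = a - 1 := by rw [hi, map_add, Finsupp.degree_single, hc]
    rw [Finset.singleton_biUnion] at h1
    refine ⟨⟨Or.inr h1, fun v => ?_⟩, hb⟩
    have := Finsupp.le_degree v b
    omega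
  · rintro ⟨⟨h1, -⟩, h2⟩
    have hb : b ≠ 0 := by
      rintro rfl
      simp at h2
      omega
    obtain ⟨i, hi⟩ := Finsupp.support_nonempty_iff.2 hb
    have hle : Finsupp.single i 1 ≤ b := by
      rw [Finsupp.single_le_iff, Nat.one_le_iff_ne_zero]
      exact Finsupp.mem_support_iff.1 hi
    have hbi := tsub_add_cancel_of_le hle
    refine ⟨by simp, by simpa using h1.resolve_left hb, b - Finsupp.single i 1, ?_, ?_⟩
    · have := congrArg Finsupp.degree hbi
      rwa [map_add, Finsupp.degree_single, h2] at this
    · intro b' hb'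
      rw [Finset.mem_singleton.1 hb']
      exact ⟨i, hbi.symm⟩

/-- The common vector `c` is $x_u^i x_v^j$. Thus an edge of the subdivision consists of the two
quotients of the degree $a$ monomial $x_u^{i+1}x_v^{j+1}$ by a variable, which are the two terms of
one kernel equation. -/
theorem exists_of_pair_mem_hesd (hdim : ∀ s ∈ Δ, s.card ≤ 2) {b b' : V →₀ ℕ} (hbb : b ≠ b')
    (h : {b, b'} ∈ Δ.hesd (a - 1)) :
    ∃ u v i j, u ≠ v ∧ {u, v} ∈ Δ ∧ i + j + 1 = a - 1 ∧
      b = Finsupp.single u i + Finsupp.single v (j + 1) ∧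
      b' = Finsupp.single u (i + 1) + Finsupp.single v j := by
  obtain ⟨-, h1, c, hc, h2⟩ := h
  obtain ⟨v, rfl⟩ := h2 b (by simp)
  obtain ⟨u, rfl⟩ := h2 b' (by simp)
  have huv : u ≠ v := by
    rintro rfl
    exact hbb rfl
  rw [Finset.biUnion_insert, Finset.singleton_biUnion] at h1
  have hs := face_eq hdim h1 huv (by simp) (by simp)
  have hcs : c.support ⊆ {u, v} := by
    rw [← hs]
    intro w hw
    simp only [Finset.mem_union, Finsupp.mem_support_iff, Finsupp.add_apply] at hw ⊢
    omega
  have hcc := eq_single_add_single huv hcs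
  refine ⟨u, v, c u, c v, huv, hs ▸ h1, ?_, ?_, ?_⟩
  · rw [← hc, hcc, degree_pair, ← hcc]
  · rw [Finsupp.single_add, ← add_assoc, ← hcc]
  · rw [Finsupp.single_add, add_right_comm, ← hcc]

theorem pair_mem_hesd {u v : V} (he : {u, v} ∈ Δ) {i j : ℕ}
    (hij : i + j + 1 = a - 1) :
    {Finsupp.single u i + Finsupp.single v (j + 1),
      Finsupp.single u (i + 1) + Finsupp.single v j} ∈ Δ.hesd (a - 1) := by
  refine ⟨by simp, ?_, Finsupp.single u i + Finsupp.single v j, by rw [degree_pair, hij], ?_⟩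
  · rw [Finset.biUnion_insert, Finset.singleton_biUnion]
    convert he using 1
    ext w
    simp only [Finset.mem_union, Finsupp.mem_support_iff, Finsupp.add_apply, Finsupp.single_apply,
      Finset.mem_insert, Finset.mem_singleton]
    grind
  · intro b hb
    rw [Finset.mem_insert, Finset.mem_singleton] at hb
    rcases hb with rfl | rfl
    · exact ⟨v, by rw [Finsupp.single_add, ← add_assoc]⟩
    · exact ⟨u, by rw [Finsupp.single_add, add_right_comm]⟩

variable {K : Type*} [Field K] [Fintype V]

/-- Functions on the subdivision that change sign along each edge are constant up to sign, so
that they vanish or yield a two-coloring. -/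
theorem IsKilled.eq_zero_of_not_isBipartite [CharZero K] (hΔ : Δ.IsConnectedGraph) (ha : 1 < a)
    (hbip : ¬ (Δ.hesd (a - 1)).skeletonGraph.IsBipartite) {f : (V →₀ ℕ) → K}
    (hf : IsKilled Δ a (a - 1) (fun _ => 1) f) :
    ∀ m ∈ standardSet Δ a (a - 1), f m = 0 := by
  classical
  obtain ⟨u₀, hu₀⟩ := hΔ.2.nonempty
  set t := f (Finsupp.single u₀ (a - 1)) with ht
  have hpm : ∀ m ∈ standardSet Δ a (a - 1), f m = t ∨ f m = -t := fun m hm =>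
    hf.eq_or_eq_neg hΔ hu₀ (by omega) (by omega) hm
  by_cases ht0 : t = 0
  · intro m hm
    simpa [ht0] using hpm m hm
  -- All values are `t` or `-t`, and the sign changes along each edge, so the sign is a
  -- two-coloring.
  · refine absurd ⟨SimpleGraph.Coloring.mk (fun b => if f b.1 = t then (0 : Fin 2) else 1) ?_⟩ hbip
    rintro ⟨b, hb⟩ ⟨b', hb'⟩ ⟨hne, hadj⟩
    obtain ⟨u, v, i, j, huv, he, hij, rfl, rfl⟩ :=
      exists_of_pair_mem_hesd hΔ.1 (fun h => hne (Subtype.ext h)) hadj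
    have h := hf.edge huv he hij (by omega) (by omega)
    simp only [one_mul] at h
    have h1 := hpm _ ((singleton_mem_hesd_iff ha).1 hb)
    have hcol : f (Finsupp.single u i + Finsupp.single v (j + 1)) = t ↔
        ¬ f (Finsupp.single u (i + 1) + Finsupp.single v j) = t := by
      constructor
      · intro h3 h4
        rw [h3, h4] at h
        -- Characteristic $0$ enters here: `t + t = 0` forces `t = 0`.
        exact ht0 (add_self_eq_zero.1 h)
      · intro h3
        by_contra h4
        have h5 := h1.resolve_left h4
        rw [h5] at h
        exact h3 (by linear_combination h)
    by_cases h3 : f (Finsupp.single u (i + 1) + Finsupp.single v j) = t <;>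
      simp only [hcol, h3, not_true_eq_false, not_false_eq_true, if_true, if_false] <;> decide

/-- A two-coloring of the subdivision gives an element of degree `a - 1` killed by a given linear
form. -/
theorem exists_isKilled_of_isBipartite (hΔ : Δ.IsConnectedGraph) (ha : 1 < a)
    (hbip : (Δ.hesd (a - 1)).skeletonGraph.IsBipartite) (c : V → K) :
    ∃ f : (V →₀ ℕ) → K, IsKilled Δ a (a - 1) c f ∧ ∃ m ∈ standardSet Δ a (a - 1), f m ≠ 0 := by
  classical
  -- In degree $a$ there are no pure powers, so the edge equations are the whole system.
  have hedge : ∀ f : (V →₀ ℕ) → K, (∀ u v i j, u ≠ v → {u, v} ∈ Δ → i + j + 1 = a - 1 →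
      c u * f (Finsupp.single u i + Finsupp.single v (j + 1)) +
        c v * f (Finsupp.single u (i + 1) + Finsupp.single v j) = 0) →
      IsKilled Δ a (a - 1) c f := by
    intro f hf m hm
    obtain ⟨h, -⟩ | ⟨u, -, -, h, -⟩ | ⟨u, v, i, j, huv, he, hi, hj, -, -, hij, rfl⟩ :=
      standardSet_cases hΔ.1 hm
    · omega
    · omega
    · obtain ⟨i, rfl⟩ := Nat.exists_eq_add_of_le' hi
      obtain ⟨j, rfl⟩ := Nat.exists_eq_add_of_le' hj
      rw [sum_support_pair huv]
      exact hf u v i j huv he (by omega)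
  by_cases hc : ∃ u, {u} ∈ Δ ∧ c u ≠ 0
  · obtain ⟨u₀, hu₀, hcu⟩ := hc
    obtain ⟨col⟩ := hbip
    -- The coloring as a sign; the value `1` off the subdivision only keeps `s` nonzero everywhere.
    let s : (V →₀ ℕ) → K := fun b =>
      if h : {b} ∈ Δ.hesd (a - 1) then if col ⟨b, h⟩ = 0 then 1 else -1 else 1
    have hs : ∀ b, s b ≠ 0 := by
      intro b
      simp only [s]
      split_ifs <;> simp
    -- Twisting the sign by $c^b$ makes both terms of an edge equation equal to $\pm
    -- c_u^{i+1}c_v^{j+1}$, with opposite signs, even where some coefficients vanish.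
    refine ⟨fun b => s b * b.prod fun v n => c v ^ n, hedge _ ?_, Finsupp.single u₀ (a - 1),
      single_mem_standardSet hu₀ (by omega), ?_⟩
    · intro u v i j huv he hij
      have hmem := pair_mem_hesd he hij
      have hne := pair_ne_pair huv i j
      have h1 := face_of_subset hmem (t := {Finsupp.single u i + Finsupp.single v (j + 1)})
        (by simp) (by simp)
      have h2 := face_of_subset hmem (t := {Finsupp.single u (i + 1) + Finsupp.single v j})
        (by simp) (by simp)
      have hcol := col.valid (v := ⟨_, h1⟩) (w := ⟨_, h2⟩)
        ⟨fun h => hne (congrArg Subtype.val h), hmem⟩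
      have hsum : s (Finsupp.single u i + Finsupp.single v (j + 1)) +
          s (Finsupp.single u (i + 1) + Finsupp.single v j) = 0 := by
        simp only [s, dif_pos h1, dif_pos h2]
        generalize col ⟨_, h1⟩ = x at hcol
        generalize col ⟨_, h2⟩ = y at hcol
        fin_cases x <;> fin_cases y <;> simp at hcol ⊢
      have hprod : ∀ i j : ℕ, (Finsupp.single u i + Finsupp.single v j).prod
          (fun v n => c v ^ n) = c u ^ i * c v ^ j := by
        intro i j
        rw [Finsupp.prod_add_index' (by simp) (by simp [pow_add]), Finsupp.prod_single_index
          (by simp), Finsupp.prod_single_index (by simp)]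
      rw [hprod, hprod]
      linear_combination (c u ^ (i + 1) * c v ^ (j + 1)) * hsum
    · beta_reduce
      rw [Finsupp.prod_single_index (by simp)]
      exact mul_ne_zero (hs _) (pow_ne_zero _ hcu)
  -- If `c` vanishes on all vertices of `Δ`, the form is zero in $A$ and kills everything.
  · push Not at hc
    obtain ⟨u₀, hu₀⟩ := hΔ.2.nonempty
    refine ⟨fun _ => 1, hedge _ ?_, Finsupp.single u₀ (a - 1),
      single_mem_standardSet hu₀ (by omega), one_ne_zero⟩
    intro u v i j huv he hij
    rw [hc u (vertex_of_edge he), hc v (vertex_of_edge (Finset.pair_comm u v ▸ he))]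
    simp

end Subdivision

/-! ### Dimensions of the graded pieces up to degree $a$. -/

section Counting

/-- Counted by support: a vertex carries one pure power, which dies at `d = a`. An edge carries the
`d - 1` splittings of `d` into two positive parts, all below `a` because `d ≤ a`. -/
theorem ncard_standardSet [Finite V] (hdim : ∀ s ∈ Δ, s.card ≤ 2) (hd0 : 0 < d)
    (hd : d ≤ a) :
    (standardSet Δ a d).ncard =
      (if d < a then Δ.numFaces 0 else 0) + Δ.numFaces 1 * (d - 1) := by
  classical
  have hS := standardSet_finite Δ a d
  have hF : ∀ k, {s : Finset V | s ∈ Δ ∧ s.card = k + 1}.Finite := fun k => Set.toFinite _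
  have hdisj : Disjoint (hF 0).toFinset (hF 1).toFinset := by
    rw [Finset.disjoint_left]
    intro s h1 h2
    simp only [Set.Finite.mem_toFinset, Set.mem_ofPred_eq] at h1 h2
    omega
  rw [Set.ncard_eq_toFinset_card _ hS, Finset.card_eq_sum_card_fiberwise
    (f := Finsupp.support) (t := (hF 0).toFinset ∪ (hF 1).toFinset), Finset.sum_union hdisj,
    PreAbstractSimplicialComplex.numFaces, PreAbstractSimplicialComplex.numFaces,
    Set.ncard_eq_toFinset_card _ (hF 0), Set.ncard_eq_toFinset_card _ (hF 1)]
  · congr 1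
    · rw [Finset.sum_congr rfl (g := fun _ => if d < a then 1 else 0)]
      · split_ifs <;> simp
      · intro s hs
        simp only [Set.Finite.mem_toFinset, Set.mem_ofPred_eq, zero_add, Finset.card_eq_one] at hs
        obtain ⟨hs, u, rfl⟩ := hs
        split_ifs with hda
        · rw [Finset.card_eq_one]
          refine ⟨Finsupp.single u d, ?_⟩
          ext m
          simp only [Finset.mem_filter, Set.Finite.mem_toFinset, Finset.mem_singleton]
          constructor
          · rintro ⟨h1, h2⟩
            have h3 := (Finsupp.support_eq_singleton.1 h2).2
            have h4 := h1.2
            rw [h3, Finsupp.degree_single] at h4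
            rw [h3, h4]
          · rintro rfl
            exact ⟨single_mem_standardSet hs hda, Finsupp.support_single _ hd0.ne'⟩
        · rw [Finset.card_eq_zero, Finset.filter_eq_empty_iff]
          intro m hm h2
          rw [Set.Finite.mem_toFinset] at hm
          have h3 := (Finsupp.support_eq_singleton.1 h2).2
          have h4 := hm.2
          have h5 := hm.1.2 u
          rw [h3, Finsupp.degree_single] at h4
          omega
    · rw [Finset.sum_const_nat]
      intro s hs
      simp only [Set.Finite.mem_toFinset, Set.mem_ofPred_eq, Nat.reduceAdd,
        Finset.card_eq_two] at hs
      obtain ⟨hs, u, v, huv, rfl⟩ := hs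
      rw [← Nat.card_Ico 1 d]
      symm
      refine Finset.card_bij (fun i _ => Finsupp.single u i + Finsupp.single v (d - i)) ?_ ?_ ?_
      · intro i hi
        rw [Finset.mem_Ico] at hi
        simp only [Finset.mem_filter, Set.Finite.mem_toFinset]
        refine ⟨?_, support_pair huv (by omega) (by omega)⟩
        have := pair_mem_standardSet (a := a) huv hs (i := i) (j := d - i) (by omega) (by omega)
        rwa [show i + (d - i) = d by omega] at this
      · intro i _ j _ h
        have := DFunLike.congr_fun h u
        simpa [huv, huv.symm] using this
      · intro m hm
        simp only [Finset.mem_filter, Set.Finite.mem_toFinset] at hm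
        obtain ⟨⟨h1, h2⟩, h3⟩ := hm
        have h4 := eq_single_add_single huv h3.le
        have h5 : m u + m v = d := by rw [← h2, h4, degree_pair, ← h4]
        have hu : m u ≠ 0 := Finsupp.mem_support_iff.1 (by simp [h3])
        have hv : m v ≠ 0 := Finsupp.mem_support_iff.1 (by simp [h3])
        refine ⟨m u, Finset.mem_Ico.2 ⟨by omega, by omega⟩, ?_⟩
        rw [show d - m u = m v by omega, ← h4]
  · intro m hm
    simp only [Set.Finite.coe_toFinset] at hm
    simp only [Finset.coe_union, Set.Finite.coe_toFinset, Set.mem_union, Set.mem_ofPred_eq]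
    have hm0 : m ≠ 0 := by
      rintro rfl
      have := hm.2
      simp at this
      omega
    have h1 := hm.1.1.resolve_left hm0
    have h2 := hdim _ h1
    have h3 := Finset.card_pos.2 (face_nonempty h1)
    have : m.support.card = 1 ∨ m.support.card = 2 := by omega
    simpa [h1] using this

end Counting

/-! ### Surjectivity from degree $a$ on. -/

section Surjective

variable {K : Type*} [Field K]

/-- Modulo the image, moving a unit of exponent from `v` to `u` only changes the sign of a monomial
on an edge. Repeating this raises the exponent of `u` to `a`, where the monomial is zero. -/
theorem mulMap_surjective [Fintype V] (hdim : ∀ s ∈ Δ, s.card ≤ 2) (hd : a ≤ d) :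
    Function.Surjective (mulMap (definingIdeal K Δ a) (linearForm _ fun _ => 1) d) := by
  classical
  set J := definingIdeal K Δ a
  set ℓ : MvPolynomial V K := ∑ v, C 1 * X v with hℓ
  -- A third variable would give a support with three elements, so only two terms of the product
  -- survive.
  have hstep : ∀ (u v : V) (i j : ℕ), u ≠ v → 0 < i → 0 < j →
      ℓ * monomial (Finsupp.single u i + Finsupp.single v j) 1 -
        (monomial (Finsupp.single u (i + 1) + Finsupp.single v j) 1 +
          monomial (Finsupp.single u i + Finsupp.single v (j + 1)) 1) ∈ J := by
    intro u v i j huv hi hj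
    have h1 : ∀ w, (C 1 * X w : MvPolynomial V K) *
        monomial (Finsupp.single u i + Finsupp.single v j) 1 =
        monomial (Finsupp.single u i + Finsupp.single v j + Finsupp.single w 1) 1 := by
      intro w
      rw [C_1, one_mul, X, monomial_mul, one_mul, add_comm]
    rw [hℓ, Finset.sum_mul, ← Finset.sum_sdiff (Finset.subset_univ {u, v}), Finset.sum_pair huv,
      h1, h1, add_right_comm (Finsupp.single u i), ← Finsupp.single_add,
      add_assoc (Finsupp.single u i), ← Finsupp.single_add, add_sub_cancel_right]
    refine Ideal.sum_mem _ fun w hw => ?_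
    simp only [Finset.mem_sdiff, Finset.mem_univ, true_and, Finset.mem_insert,
      Finset.mem_singleton, not_or] at hw
    rw [h1]
    refine monomial_mem_definingIdeal (fun h => ?_) _
    have hs : ∀ x ∈ ({u, v, w} : Finset V),
        x ∈ (Finsupp.single u i + Finsupp.single v j + Finsupp.single w 1).support := by
      intro x hx
      simp only [Finset.mem_insert, Finset.mem_singleton] at hx
      simp only [Finsupp.mem_support_iff, Finsupp.add_apply, Finsupp.single_apply]
      grind
    rcases h.1 with h | h
    · rw [h] at hs
      simpa using hs u (by simp)
    · have h2 := (Finset.card_le_card hs).trans (hdim _ h)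
      rw [Finset.card_insert_of_notMem (by grind), Finset.card_pair (Ne.symm hw.2)] at h2
      omega
  -- Induction on the distance `k` from `i` to `a`. As `d ≥ a`, the exponent of `v` is at least two
  -- while `i < a`, so it stays positive after giving up a unit, as `hstep` needs.
  have hmon : ∀ (u v : V) (k i j : ℕ), u ≠ v → i + k = a → 0 < i → i + j = d + 1 →
      ∃ p : MvPolynomial V K, p.IsHomogeneous d ∧
        ℓ * p - monomial (Finsupp.single u i + Finsupp.single v j) 1 ∈ J := by
    intro u v k
    induction k with
    | zero =>
      intro i j huv hi hi0 hij
      refine ⟨0, isHomogeneous_zero _ _ _, ?_⟩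
      rw [mul_zero, zero_sub]
      refine J.neg_mem (monomial_mem_definingIdeal (fun h => ?_) _)
      have := h.2 u
      simp [huv] at this
      omega
    | succ k ih =>
      intro i j huv hi hi0 hij
      obtain ⟨j, rfl⟩ : ∃ j', j = j' + 1 := ⟨j - 1, by omega⟩
      obtain ⟨p, hp, hpJ⟩ := ih (i + 1) j huv (by omega) (by omega) (by omega)
      refine ⟨monomial (Finsupp.single u i + Finsupp.single v j) 1 - p,
        (isHomogeneous_monomial _ (by rw [degree_pair]; omega)).sub hp, ?_⟩
      convert J.sub_mem (hstep u v i j huv hi0 (by omega)) hpJ using 1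
      ring
  intro y
  obtain ⟨q, hq, rfl⟩ := exists_mk_eq y
  suffices h : ∃ p : MvPolynomial V K, p.IsHomogeneous d ∧ ℓ * p - q ∈ J by
    obtain ⟨p, hp, hpq⟩ := h
    refine ⟨⟨_, mk_mem_gradedPiece hp⟩, Subtype.ext ?_⟩
    rw [linearForm, mulMap_mk (isHomogeneous_linearForm _) hp]
    exact Ideal.Quotient.eq.2 hpq
  have hterm : ∀ m ∈ q.support, ∃ p : MvPolynomial V K, p.IsHomogeneous d ∧
      ℓ * p - monomial m (coeff m q) ∈ J := by
    intro m hm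
    by_cases hst : IsStandard Δ a m
    · have hdeg : m.degree = d + 1 := by
        by_contra h
        exact mem_support_iff.1 hm (hq.coeff_eq_zero h)
      obtain ⟨h, -⟩ | ⟨u, -, -, h, -⟩ | ⟨u, v, i, j, huv, -, hi, -, hia, -, hij, rfl⟩ :=
        standardSet_cases hdim (⟨hst, hdeg⟩ : m ∈ standardSet Δ a (d + 1))
      · omega
      · omega
      · obtain ⟨p, hp, hpJ⟩ := hmon u v (a - i) i j huv (by omega) hi hij
        refine ⟨C (coeff (Finsupp.single u i + Finsupp.single v j) q) * p, hp.C_mul _, ?_⟩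
        convert J.mul_mem_left (C (coeff (Finsupp.single u i + Finsupp.single v j) q)) hpJ using 1
        rw [mul_sub, C_mul_monomial, mul_one]
        ring
    · refine ⟨0, isHomogeneous_zero _ _ _, ?_⟩
      rw [mul_zero, zero_sub]
      exact J.neg_mem (monomial_mem_definingIdeal hst _)
  choose! p hp hpJ using hterm
  refine ⟨∑ m ∈ q.support, p m, IsHomogeneous.sum _ _ _ hp, ?_⟩
  have h := Ideal.sum_mem J hpJ
  rwa [Finset.sum_sub_distrib, ← Finset.mul_sum, support_sum_monomial_coeff] at h

end Surjective

end Combinatorics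

/-- For a connected graph `Δ` with `v = Δ.numFaces 0` vertices and `e = Δ.numFaces 1` edges and for
`a > 1`, the algebra `A_Δ(a)` has the WLP over a field of characteristic zero if and only if
`v > e`, or `v ≤ e` and the `(a - 1)`-fold half-hollow edgewise subdivision of `Δ` is not
bipartite. -/
theorem theoremt {K : Type*} [Field K] [CharZero K] {V : Type*} [Finite V] [DecidableEq V]
    (Δ : PreAbstractSimplicialComplex V) (hΔ : Δ.IsConnectedGraph) (a : ℕ) (ha : 1 < a) :
    HasWLP (definingIdeal K Δ a) ↔
      Δ.numFaces 1 < Δ.numFaces 0 ∨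
        (Δ.numFaces 0 ≤ Δ.numFaces 1 ∧ ¬ (Δ.hesd (a - 1)).skeletonGraph.IsBipartite) := by
  have := Fintype.ofFinite V
  have hr1 : Module.finrank K (gradedPiece (definingIdeal K Δ a) (a - 1)) =
      Δ.numFaces 0 + Δ.numFaces 1 * (a - 2) := by
    rw [finrank_gradedPiece, ncard_standardSet hΔ.1 (by omega) (by omega), if_pos (by omega)]
    rfl
  have hr2 : Module.finrank K (gradedPiece (definingIdeal K Δ a) (a - 1 + 1)) =
      Δ.numFaces 1 * (a - 2) + Δ.numFaces 1 := by
    rw [finrank_gradedPiece, ncard_standardSet hΔ.1 (by omega) (by omega), if_neg (by omega),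
      zero_add, ← Nat.mul_succ]
    congr 1
    omega
  obtain ⟨u₀, hu₀⟩ := hΔ.2.nonempty
  constructor
  · rintro ⟨L, hL⟩
    rw [or_iff_not_imp_left, not_lt]
    refine fun hle => ⟨hle, fun hbip => ?_⟩
    obtain ⟨c, rfl⟩ := exists_eq_linearForm L
    obtain ⟨f, hf, m, hm, hfm⟩ := exists_isKilled_of_isBipartite hΔ ha hbip c
    -- Since $v\le e$, the source is no larger than the target, so a surjection would also be
    -- injective.
    have hinj : Function.Injective (mulMap (definingIdeal K Δ a) (linearForm _ c) (a - 1)) := by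
      refine (hL (a - 1)).elim id fun hsurj => ?_
      have := LinearMap.finrank_le_finrank_of_surjective hsurj
      exact (LinearMap.injective_iff_surjective_of_finrank_eq_finrank (by omega)).2 hsurj
    exact hfm ((mulMap_injective_iff _ _).1 hinj f hf m hm)
  · intro h
    refine ⟨linearForm _ fun _ => 1, fun d => ?_⟩
    rcases lt_trichotomy (d + 1) a with hd | hd | hd
    · exact Or.inl ((mulMap_injective_iff _ _).2 fun f hf => hf.eq_zero hΔ.1 ⟨u₀, hu₀⟩ hd)
    · obtain rfl : d = a - 1 := by omega
      rcases h with hlt | ⟨-, hbip⟩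
      · right
        -- The source exceeds the target by $v-e\ge 1$, so a kernel of dimension at most one leaves
        -- enough rank to fill the target.
        have hker := finrank_ker_mulMap_le_one (K := K) (Δ := Δ) (a := a) (a - 1) (fun _ => 1)
          (Finsupp.single u₀ (a - 1)) (single_mem_standardSet hu₀ (by omega)) fun f hf h0 m hm => by
            have h1 := hf.eq_or_eq_neg hΔ hu₀ (by omega) (by omega) hm
            rwa [h0, neg_zero, or_self] at h1
        have hrk := LinearMap.finrank_range_add_finrank_ker
          (mulMap (definingIdeal K Δ a) (linearForm _ fun _ => 1) (a - 1))
        rw [← LinearMap.range_eq_top]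
        apply Submodule.eq_top_of_finrank_eq
        have := Submodule.finrank_le (LinearMap.range
          (mulMap (definingIdeal K Δ a) (linearForm _ fun _ => 1) (a - 1)))
        omega
      · exact Or.inl ((mulMap_injective_iff _ _).2 fun f hf =>
          hf.eq_zero_of_not_isBipartite hΔ ha hbip)
    · exact Or.inr (mulMap_surjective hΔ.1 (by omega))
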